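/- Let $m$ be a positive integer and let $\rho=(\rho_1,\dots,\rho_m)\in(0,1]^m$. Write $\Delta(0;\rho)=\{z\in\mathbb{C}^m : |z_i|<\rho_i \text{ for } 1\le i\le m\}$, and let $\overline{\mathbb{Q}}\subset\mathbb{C}$ be the field of algebraic numbers. A power series $f(z)=\sum_{k\in\mathbb{N}_0^m} f_k z_1^{k_1}\cdots z_m^{k_m}$ is said to have polyradius of convergence $\rho$ if its domain of convergence, that is, the interior of the set of points $z\in\mathbb{C}^m$ at which it converges absolutely, is exactly $\Delta(0;\rho)$. Such an $f$ is called transcendental if the only polynomial $P\in\mathbb{C}[X_1,\dots,X_{m+1}]$ with $P(z_1,\dots,z_m,f(z))=0$ for all $z\in\Delta(0;\rho)$ is the zero polynomial, and its exceptional set is $$S_f=\{\alpha\in\overline{\mathbb{Q}}^m\cap\Delta(0;\rho) : f(\alpha)\in\overline{\mathbb{Q}}\}.$$ Let $S\subseteq\overline{\mathbb{Q}}^m\cap\Delta(0;\rho)$ be a set that contains $(0,\dots,0)$ and is closed under coordinatewise complex conjugation $(z_1,\dots,z_m)\mapsto(\overline{z_1},\dots,\overline{z_m})$. Then there are uncountably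 many transcendental power series $f$ in $m$ variables with integer coefficients and polyradius of convergence $\rho$ such that $S_f=S$. -/

import Mathlib

namespace Exceptional

/-- The open polydisc `Δ(w; ρ)` in `ℂᵐ`. -/
def polydisc {m : ℕ} (w : Fin m → ℂ) (ρ : Fin m → ℝ) : Set (Fin m → ℂ) :=
  {z | ∀ i, ‖z i - w i‖ < ρ i}

/-- The term of multi-index `k` of the power series `f` at the point `z`. -/
noncomputable def term {m : ℕ} (f : MvPowerSeries (Fin m) ℂ) (z : Fin m → ℂ)
    (k : Fin m →₀ ℕ) : ℂ :=
  MvPowerSeries.coeff k f * ∏ i, z i ^ k i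

/-- The domain of convergence of a power series: the interior of the set of points
at which it converges absolutely. -/
def convergenceDomain {m : ℕ} (f : MvPowerSeries (Fin m) ℂ) : Set (Fin m → ℂ) :=
  interior {z | Summable fun k => ‖term f z k‖}

/-- `f` has polyradius of convergence `ρ`: its domain of convergence is exactly `Δ(0; ρ)`. -/
def HasPolyradius {m : ℕ} (f : MvPowerSeries (Fin m) ℂ) (ρ : Fin m → ℝ) : Prop :=
  convergenceDomain f = polydisc 0 ρ

/-- The function that a power series defines (meaningful where the series converges). -/
noncomputable def toFun {m : ℕ} (f : MvPowerSeries (Fin m) ℂ) (z : Fin m → ℂ) : ℂ :=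
  ∑' k, term f z k

/-- `F` is transcendental on `Ω`: the only complex polynomial `P` in `m + 1` variables with
`P(z₁, …, zₘ, F(z)) = 0` on all of `Ω` is the zero polynomial. -/
def IsTranscendentalOn {m : ℕ} (Ω : Set (Fin m → ℂ)) (F : (Fin m → ℂ) → ℂ) : Prop :=
  ∀ P : MvPolynomial (Fin (m + 1)) ℂ,
    (∀ z ∈ Ω, MvPolynomial.eval (Fin.snoc z (F z) : Fin (m + 1) → ℂ) P = 0) → P = 0

/-- The points of `Ω` with algebraic coordinates. -/
def algebraicPoints {m : ℕ} (Ω : Set (Fin m → ℂ)) : Set (Fin m → ℂ) :=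
  {α | α ∈ Ω ∧ ∀ i, IsAlgebraic ℚ (α i)}

/-- The exceptional set of `F : Ω → ℂ`: the algebraic points of `Ω` at which `F` takes an
algebraic value. -/
def exceptionalSet {m : ℕ} (Ω : Set (Fin m → ℂ)) (F : (Fin m → ℂ) → ℂ) : Set (Fin m → ℂ) :=
  {α | α ∈ algebraicPoints Ω ∧ IsAlgebraic ℚ (F α)}

/-- A power series with integer coefficients, regarded as a complex power series. -/
noncomputable def toComplex {m : ℕ} (f : MvPowerSeries (Fin m) ℤ) : MvPowerSeries (Fin m) ℂ :=
  MvPowerSeries.map (Int.castRingHom ℂ) f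

end Exceptional

/-!
Values at finitely many nonzero points can be prescribed by an integer series: if the real
polynomial `p` has constant coefficient `1` and vanishes at the points, then for any real
polynomial `G` there is a series `h` with coefficients in `[0, 1)`, determined one coefficient after
the other, such that `G + p * h` has integer coefficients; its values at the points are those of
`G`. Multiplying by a high power of a variable makes the coefficients small compared to the degree,
at the cost of attaining small values only.

Enumerate the nonzero algebraic points of the polydisc up to conjugation. Starting from an integer
series of polyradius `ρ`, the `n`-th correction leaves the values at the earlier points unchanged
and moves the value at the `n`-th point by a small amount into a prescribed dense set of real
numbers or of complex numbers, according to whether the point is real. Algebraic and transcendental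
numbers are both dense, even without one point, so the exceptional set can be made `S` while any
given countable set of series is avoided. The integer series that are algebraic over the
polynomials form such a set: a relation over `ℂ` yields one over `ℚ`, and there are countably
many of those.
-/

namespace Exceptional

open Finset Filter Topology

section Evaluation

variable {m : ℕ} {F G : MvPowerSeries (Fin m) ℂ} {z : Fin m → ℂ}

/-- Absolute convergence of the power series `F` at the point `z`. -/
def AbsConv (F : MvPowerSeries (Fin m) ℂ) (z : Fin m → ℂ) : Prop :=
  Summable fun k => ‖term F z k‖

theorem AbsConv.hasSum (hF : AbsConv F z) : HasSum (term F z) (toFun F z) :=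
  (Summable.of_norm hF).hasSum

theorem absConv_of_mem_convergenceDomain (hz : z ∈ convergenceDomain F) : AbsConv F z :=
  interior_subset (s := {z | AbsConv F z}) hz

theorem HasPolyradius.absConv {ρ : Fin m → ℝ} (h : HasPolyradius F ρ) (hz : z ∈ polydisc 0 ρ) :
    AbsConv F z :=
  absConv_of_mem_convergenceDomain (h.symm.subset hz)

theorem term_add (F G : MvPowerSeries (Fin m) ℂ) (z : Fin m → ℂ) :
    term (F + G) z = term F z + term G z := by
  ext k
  simp [term, add_mul]

theorem term_mul (F G : MvPowerSeries (Fin m) ℂ) (z : Fin m → ℂ) (k : Fin m →₀ ℕ) :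
    term (F * G) z k = ∑ x ∈ antidiagonal k, term F z x.1 * term G z x.2 := by
  rw [term, MvPowerSeries.coeff_mul, sum_mul]
  refine sum_congr rfl fun x hx => ?_
  rw [← mem_antidiagonal.1 hx]
  simp only [term, Finsupp.add_apply, pow_add, prod_mul_distrib]
  ring

theorem term_smul (F : MvPowerSeries (Fin m) ℂ) (t : ℂ) (z : Fin m → ℂ) (k : Fin m →₀ ℕ) :
    term F (t • z) k = t ^ k.degree * term F z k := by
  simp only [term, Pi.smul_apply, smul_eq_mul, mul_pow, prod_mul_distrib, prod_pow_eq_pow_sum,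
    Finsupp.degree_eq_sum]
  ring

theorem norm_term (F : MvPowerSeries (Fin m) ℂ) (z : Fin m → ℂ) (k : Fin m →₀ ℕ) :
    ‖term F z k‖ = ‖MvPowerSeries.coeff k F‖ * ∏ i, ‖z i‖ ^ k i := by
  simp [term]

theorem AbsConv.add (hF : AbsConv F z) (hG : AbsConv G z) : AbsConv (F + G) z := by
  refine Summable.of_nonneg_of_le (fun _ => norm_nonneg _) (fun k => ?_) (Summable.add hF hG)
  rw [term_add]
  exact norm_add_le _ _

theorem toFun_add (hF : AbsConv F z) (hG : AbsConv G z) :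
    toFun (F + G) z = toFun F z + toFun G z := by
  rw [toFun, term_add]
  exact (hF.hasSum.add hG.hasSum).tsum_eq

theorem toFun_sum {ι : Type*} (s : Finset ι) {F : ι → MvPowerSeries (Fin m) ℂ}
    (hF : ∀ i ∈ s, AbsConv (F i) z) : toFun (∑ i ∈ s, F i) z = ∑ i ∈ s, toFun (F i) z := by
  have hterm : term (∑ i ∈ s, F i) z = fun k => ∑ i ∈ s, term (F i) z k := by
    ext k
    simp [term, sum_mul]
  rw [toFun, hterm]
  exact (hasSum_sum fun i hi => (hF i hi).hasSum).tsum_eq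

theorem AbsConv.mul (hF : AbsConv F z) (hG : AbsConv G z) : AbsConv (F * G) z := by
  have h := summable_sum_mul_antidiagonal_of_summable_mul
    (Summable.mul_of_nonneg hF hG (fun _ => norm_nonneg _) fun _ => norm_nonneg _)
  refine Summable.of_nonneg_of_le (fun _ => norm_nonneg _) (fun k => ?_) h
  rw [term_mul]
  exact (norm_sum_le _ _).trans (sum_le_sum fun x _ => (norm_mul _ _).le)

theorem toFun_mul (hF : AbsConv F z) (hG : AbsConv G z) :
    toFun (F * G) z = toFun F z * toFun G z := by
  simp only [toFun]
  rw [hF.hasSum.summable.tsum_mul_tsum_eq_tsum_sum_antidiagonal hG.hasSum.summable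
    (summable_mul_of_summable_norm hF hG)]
  exact tsum_congr fun k => term_mul F G z k

theorem hasSum_term_coe (P : MvPolynomial (Fin m) ℂ) (z : Fin m → ℂ) :
    HasSum (term (P : MvPowerSeries (Fin m) ℂ) z) (MvPolynomial.eval z P) := by
  rw [MvPolynomial.eval_eq']
  refine hasSum_sum_of_ne_finset_zero fun k hk => ?_
  rw [term, MvPolynomial.coeff_coe, MvPolynomial.notMem_support_iff.1 hk, zero_mul]

theorem absConv_coe (P : MvPolynomial (Fin m) ℂ) (z : Fin m → ℂ) :
    AbsConv (P : MvPowerSeries (Fin m) ℂ) z :=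
  (hasSum_term_coe P z).summable.norm

theorem toFun_coe (P : MvPolynomial (Fin m) ℂ) (z : Fin m → ℂ) :
    toFun (P : MvPowerSeries (Fin m) ℂ) z = MvPolynomial.eval z P :=
  (hasSum_term_coe P z).tsum_eq

theorem absConv_C (c : ℂ) (z : Fin m → ℂ) : AbsConv (MvPowerSeries.C c) z := by
  simpa only [MvPolynomial.coe_C] using absConv_coe (MvPolynomial.C c) z

theorem toFun_C (c : ℂ) (z : Fin m → ℂ) : toFun (MvPowerSeries.C c) z = c := by
  rw [← MvPolynomial.coe_C, toFun_coe, MvPolynomial.eval_C]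

theorem absConv_X (i : Fin m) (z : Fin m → ℂ) : AbsConv (MvPowerSeries.X i) z := by
  simpa only [MvPolynomial.coe_X] using absConv_coe (MvPolynomial.X i) z

theorem toFun_X (i : Fin m) (z : Fin m → ℂ) : toFun (MvPowerSeries.X i) z = z i := by
  rw [← MvPolynomial.coe_X, toFun_coe, MvPolynomial.eval_X]

theorem AbsConv.aeval {σ : Type*} {x : σ → MvPowerSeries (Fin m) ℂ} (hx : ∀ i, AbsConv (x i) z)
    (P : MvPolynomial σ ℂ) : AbsConv (MvPolynomial.aeval x P) z := by
  induction P using MvPolynomial.induction_on with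
  | C c =>
    simpa only [MvPolynomial.aeval_C, MvPowerSeries.algebraMap_apply,
      Algebra.algebraMap_self_apply] using absConv_C c z
  | add P Q hP hQ => simpa only [map_add] using hP.add hQ
  | mul_X P i hP => simpa only [map_mul, MvPolynomial.aeval_X] using hP.mul (hx i)

theorem toFun_aeval {σ : Type*} {x : σ → MvPowerSeries (Fin m) ℂ} (hx : ∀ i, AbsConv (x i) z)
    (P : MvPolynomial σ ℂ) :
    toFun (MvPolynomial.aeval x P) z = MvPolynomial.eval (fun i => toFun (x i) z) P := by
  induction P using MvPolynomial.induction_on with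
  | C c =>
    simpa only [MvPolynomial.aeval_C, MvPowerSeries.algebraMap_apply,
      Algebra.algebraMap_self_apply, MvPolynomial.eval_C] using toFun_C c z
  | add P Q hP hQ =>
    rw [map_add, map_add, toFun_add (.aeval hx P) (.aeval hx Q), hP, hQ]
  | mul_X P i hP =>
    rw [map_mul, map_mul, MvPolynomial.aeval_X, MvPolynomial.eval_X,
      toFun_mul (.aeval hx P) (hx i), hP]

end Evaluation

section IdentityTheorem

variable {m : ℕ} {F : MvPowerSeries (Fin m) ℂ} {ρ : Fin m → ℝ} {z : Fin m → ℂ}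

theorem isOpen_polydisc (w : Fin m → ℂ) (ρ : Fin m → ℝ) : IsOpen (polydisc w ρ) := by
  simp only [polydisc, Set.ofPred_forall]
  exact isOpen_iInter_of_finite fun i => isOpen_lt (by fun_prop) continuous_const

theorem polydisc_mono (w : Fin m → ℂ) {ρ ρ' : Fin m → ℝ} (h : ρ ≤ ρ') :
    polydisc w ρ ⊆ polydisc w ρ' :=
  fun _ hz i => (hz i).trans_le (h i)

theorem norm_lt_of_mem_polydisc (hz : z ∈ polydisc 0 ρ) (i : Fin m) : ‖z i‖ < ρ i := by
  simpa using hz i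

theorem smul_mem_polydisc {t : ℂ} (ht : ‖t‖ ≤ 1) (hz : z ∈ polydisc 0 ρ) :
    t • z ∈ polydisc 0 ρ := by
  intro i
  have hle : ‖t‖ * ‖z i‖ ≤ ‖z i‖ := mul_le_of_le_one_left (norm_nonneg _) ht
  simpa using hle.trans_lt (norm_lt_of_mem_polydisc hz i)

theorem hasSum_pow_mul_sum_term {t a : ℂ} (h : HasSum (term F (t • z)) a) :
    HasSum (fun d => t ^ d * ∑ k ∈ finsuppAntidiag univ d, term F z k) a := by
  have hfiber (d : ℕ) : ∑' k : (fun k : Fin m →₀ ℕ => k.degree) ⁻¹' {d}, term F (t • z) k =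
      t ^ d * ∑ k ∈ finsuppAntidiag univ d, term F z k := by
    have hset : (fun k : Fin m →₀ ℕ => k.degree) ⁻¹' {d} =
        ((finsuppAntidiag univ d : Finset (Fin m →₀ ℕ)) : Set (Fin m →₀ ℕ)) := by
      ext k
      simp [mem_finsuppAntidiag, Finsupp.degree_eq_sum]
    rw [hset, Finset.tsum_subtype', mul_sum]
    refine sum_congr rfl fun k hk => ?_
    rw [term_smul, Finsupp.degree_eq_sum, (mem_finsuppAntidiag.1 hk).1]
  simpa only [hfiber] using h.tsum_fiberwise fun k : Fin m →₀ ℕ => k.degree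

theorem eq_zero_of_hasSum_pow_mul {a : ℕ → ℂ}
    (h : ∀ t : ℂ, ‖t‖ < 1 → HasSum (fun d => t ^ d * a d) 0) (d : ℕ) : a d = 0 := by
  have hseries : HasFPowerSeriesAt (0 : ℂ → ℂ) (FormalMultilinearSeries.ofScalars ℂ a) 0 := by
    rw [hasFPowerSeriesAt_iff]
    filter_upwards [Metric.ball_mem_nhds (0 : ℂ) one_pos] with t ht
    simpa [FormalMultilinearSeries.coeff_ofScalars] using h t (by simpa using ht)
  exact congrFun ((FormalMultilinearSeries.ofScalars_series_eq_zero ℂ).1 hseries.eq_zero) d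

theorem eval_truncFinset (s : Finset (Fin m →₀ ℕ)) (F : MvPowerSeries (Fin m) ℂ)
    (z : Fin m → ℂ) :
    MvPolynomial.eval z (MvPowerSeries.truncFinset ℂ s F) = ∑ k ∈ s, term F z k := by
  rw [MvPowerSeries.truncFinset_apply, map_sum]
  refine sum_congr rfl fun k _ => ?_
  rw [MvPolynomial.eval_monomial, Finsupp.prod_fintype _ _ fun i => pow_zero _, term]

theorem eq_zero_of_forall_eval_eq_zero (hρ : ∀ i, 0 < ρ i) {P : MvPolynomial (Fin m) ℂ}
    (h : ∀ z ∈ polydisc 0 ρ, MvPolynomial.eval z P = 0) : P = 0 := by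
  refine MvPolynomial.funext_set (fun i => Metric.ball (0 : ℂ) (ρ i))
    (fun i => infinite_of_mem_nhds 0 (Metric.ball_mem_nhds _ (hρ i))) fun z hz => ?_
  rw [map_zero]
  exact h z fun i => by simpa using hz i trivial

theorem eq_zero_of_toFun_eq_zero (hρ : ∀ i, 0 < ρ i) (hF : ∀ z ∈ polydisc 0 ρ, AbsConv F z)
    (h : ∀ z ∈ polydisc 0 ρ, toFun F z = 0) : F = 0 := by
  classical
  have htrunc (d : ℕ) : MvPowerSeries.truncFinset ℂ (finsuppAntidiag univ d) F = 0 := by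
    refine eq_zero_of_forall_eval_eq_zero hρ fun z hz => ?_
    rw [eval_truncFinset]
    refine eq_zero_of_hasSum_pow_mul (fun t ht => hasSum_pow_mul_sum_term ?_) d
    have htz : t • z ∈ polydisc 0 ρ := smul_mem_polydisc ht.le hz
    simpa only [h _ htz] using (hF _ htz).hasSum
  ext k
  have hk : k ∈ finsuppAntidiag univ k.degree := by
    simp [mem_finsuppAntidiag, Finsupp.degree_eq_sum]
  rw [← MvPowerSeries.coeff_truncFinset_of_mem F hk, htrunc, MvPolynomial.coeff_zero, map_zero]

end IdentityTheorem

section Transcendence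

theorem algebraicIndependent_X {σ R : Type*} [CommRing R] :
    AlgebraicIndependent R (MvPowerSeries.X : σ → MvPowerSeries σ R) := by
  have hinj : Function.Injective (MvPolynomial.coeToMvPowerSeries.algHom (σ := σ) (R := R) R) := by
    intro P Q h
    simpa using h
  convert (MvPolynomial.algebraicIndependent_X σ R).map' hinj using 1
  ext1 i
  simp

-- A `K`-linear functional on `L`, applied to the coefficients of a relation over `L`, gives a
-- relation over `K`.
theorem algebraicIndependent_map {σ ι K L : Type*} [Field K] [CommRing L] [Algebra K L]
    {x : ι → MvPowerSeries σ K} (hx : AlgebraicIndependent K x) :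
    AlgebraicIndependent L fun i => MvPowerSeries.map (algebraMap K L) (x i) := by
  rw [algebraicIndependent_iff] at hx ⊢
  intro P hP
  ext d
  rw [MvPolynomial.coeff_zero, ← Module.forall_dual_apply_eq_zero_iff K]
  intro φ
  let Pφ : MvPolynomial ι K := ∑ d ∈ P.support, MvPolynomial.monomial d (φ (P.coeff d))
  have hcoeff : Pφ.coeff d = φ (P.coeff d) := by
    classical
    simp only [Pφ, MvPolynomial.coeff_sum, MvPolynomial.coeff_monomial, sum_ite_eq']
    split_ifs with hd
    · rfl
    · rw [MvPolynomial.notMem_support_iff.1 hd, map_zero]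
  have hφ (c : L) (r : K) : φ (c * algebraMap K L r) = φ c * r := by
    rw [mul_comm, ← Algebra.smul_def, map_smul, smul_eq_mul, mul_comm]
  have hroot : MvPolynomial.aeval x Pφ = 0 := by
    ext k
    have hk := congrArg (fun G => φ (MvPowerSeries.coeff k G)) hP
    simp only [MvPolynomial.aeval_def, MvPolynomial.eval₂_eq, ← map_pow, ← map_prod, map_sum,
      MvPowerSeries.algebraMap_apply, MvPowerSeries.coeff_C_mul, MvPowerSeries.coeff_map,
      map_zero, Algebra.algebraMap_self_apply, hφ] at hk
    simpa only [Pφ, map_sum, MvPolynomial.aeval_monomial, MvPowerSeries.algebraMap_apply,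
      MvPowerSeries.coeff_C_mul, map_zero, Algebra.algebraMap_self_apply, Finsupp.prod] using hk
  rw [← hcoeff, hx Pφ hroot, MvPolynomial.coeff_zero]

theorem countable_setOf_not_algebraicIndependent_snoc {m : ℕ} {R A : Type*} [CommRing R]
    [Countable R] [CommRing A] [IsDomain A] [Algebra R A] {x : Fin m → A}
    (hx : AlgebraicIndependent R x) :
    {a | ¬ AlgebraicIndependent R (Fin.snoc x a : Fin (m + 1) → A)}.Countable := by
  have hpoly : Countable (MvPolynomial (Fin m) R) := Cardinal.mk_le_aleph0_iff.1 <|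
    MvPolynomial.cardinalMk_le_max_lift.trans (by simp)
  have hadjoin : Countable (Algebra.adjoin R (Set.range x)) := by
    rw [Algebra.adjoin_range_eq_range_aeval]
    exact (Set.countable_range _).to_subtype
  refine (Algebraic.countable (Algebra.adjoin R (Set.range x)) A).mono fun a ha => ?_
  by_contra htrans
  have hsnoc : (Fin.snoc x a : Fin (m + 1) → A) ∘ (finSuccEquivLast (n := m)).symm =
      fun o => o.elim a x := by
    ext (_ | i) <;> simp
  rw [Set.mem_ofPred_eq, ← algebraicIndependent_equiv (finSuccEquivLast (n := m)).symm, hsnoc,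
    hx.option_iff_transcendental] at ha
  exact ha htrans

variable {m : ℕ}

theorem isTranscendentalOn_toFun {F : MvPowerSeries (Fin m) ℂ} {ρ : Fin m → ℝ}
    (hρ : ∀ i, 0 < ρ i) (hF : ∀ z ∈ polydisc 0 ρ, AbsConv F z)
    (h : AlgebraicIndependent ℂ
      (Fin.snoc MvPowerSeries.X F : Fin (m + 1) → MvPowerSeries (Fin m) ℂ)) :
    IsTranscendentalOn (polydisc 0 ρ) (toFun F) := by
  intro P hP
  set x : Fin (m + 1) → MvPowerSeries (Fin m) ℂ := Fin.snoc MvPowerSeries.X F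
  have hx : ∀ z ∈ polydisc 0 ρ, ∀ i, AbsConv (x i) z := fun z hz =>
    Fin.lastCases (by simpa [x] using hF z hz) fun i => by simpa [x] using absConv_X i z
  have hval (z : Fin m → ℂ) : (fun i => toFun (x i) z) = Fin.snoc z (toFun F z) :=
    funext <| Fin.lastCases (by simp [x]) fun i => by simp [x, toFun_X]
  refine algebraicIndependent_iff.1 h P (eq_zero_of_toFun_eq_zero hρ
    (fun z hz => .aeval (hx z hz) P) fun z hz => ?_)
  rw [toFun_aeval (hx z hz), hval, hP z hz]

theorem map_castRingHom_injective {σ R : Type*} [Ring R] [CharZero R] :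
    Function.Injective (MvPowerSeries.map (σ := σ) (Int.castRingHom R)) := by
  intro f g h
  ext k
  simpa using congrArg (MvPowerSeries.coeff k) h

theorem countable_setOf_not_algebraicIndependent_toComplex :
    {f : MvPowerSeries (Fin m) ℤ | ¬ AlgebraicIndependent ℂ
      (Fin.snoc MvPowerSeries.X (toComplex f) :
        Fin (m + 1) → MvPowerSeries (Fin m) ℂ)}.Countable := by
  have : IsDomain (MvPowerSeries (Fin m) ℚ) := NoZeroDivisors.to_isDomain _
  refine Set.Countable.mono ?_ ((countable_setOf_not_algebraicIndependent_snoc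
    (algebraicIndependent_X (σ := Fin m) (R := ℚ))).preimage_of_injOn
      map_castRingHom_injective.injOn)
  intro f hf hQ
  refine hf ?_
  convert algebraicIndependent_map (L := ℂ) hQ using 1
  refine funext <| Fin.lastCases ?_ fun i => by simp
  ext k
  simp [toComplex]

end Transcendence

section Majorant

variable {m : ℕ} {ρ : Fin m → ℝ} {z : Fin m → ℂ} {F : MvPowerSeries (Fin m) ℂ}

/-- The coefficients of `∏ i, (1 - z i / ρ i)⁻²`, a series of polyradius `ρ` that serves as a
majorant for the power series constructed below. -/
noncomputable def majorant (ρ : Fin m → ℝ) (k : Fin m →₀ ℕ) : ℝ :=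
  ∏ i, ((k i + 1 : ℝ) * (ρ i)⁻¹ ^ k i)

theorem summable_prod_apply {ι : Type*} [Fintype ι] {a : ι → ℕ → ℝ} (h0 : ∀ i n, 0 ≤ a i n)
    (ha : ∀ i, Summable (a i)) : Summable fun k : ι →₀ ℕ => ∏ i, a i (k i) := by
  classical
  have h : Summable fun k : ι → ℕ => ∏ i, a i (k i) := by
    refine summable_of_sum_le (c := ∏ i, ∑' n, a i n)
      (fun k => prod_nonneg fun i _ => h0 i _) fun s => ?_
    let t : ι → Finset ℕ := fun i => s.image fun k => k i
    calc ∑ k ∈ s, ∏ i, a i (k i) ≤ ∑ k ∈ Fintype.piFinset t, ∏ i, a i (k i) :=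
          sum_le_sum_of_subset_of_nonneg
            (fun k hk => Fintype.mem_piFinset.2 fun i => mem_image_of_mem _ hk)
            fun k _ _ => prod_nonneg fun i _ => h0 i _
      _ = ∏ i, ∑ n ∈ t i, a i n := (prod_univ_sum t a).symm
      _ ≤ ∏ i, ∑' n, a i n := prod_le_prod (fun i _ => sum_nonneg fun n _ => h0 i n)
          fun i _ => (ha i).sum_le_tsum _ fun n _ => h0 i n
  exact h.comp_injective DFunLike.coe_injective

theorem summable_majorant_mul (hz : z ∈ polydisc 0 ρ) :
    Summable fun k : Fin m →₀ ℕ => majorant ρ k * ∏ i, ‖z i‖ ^ k i := by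
  have hρ (i : Fin m) : 0 < ρ i := (norm_nonneg _).trans_lt (norm_lt_of_mem_polydisc hz i)
  have hr (i : Fin m) : ‖‖z i‖ / ρ i‖ < 1 := by
    rw [norm_div, norm_norm, Real.norm_of_nonneg (hρ i).le, div_lt_one (hρ i)]
    exact norm_lt_of_mem_polydisc hz i
  have hgeom (i : Fin m) : Summable fun n : ℕ => (n + 1 : ℝ) * (‖z i‖ / ρ i) ^ n := by
    simpa only [pow_one, add_mul, one_mul] using
      (summable_pow_mul_geometric_of_norm_lt_one 1 (hr i)).add
        (summable_geometric_of_norm_lt_one (hr i))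
  refine (summable_prod_apply (fun i n => ?_) hgeom).congr fun k => ?_
  · have := hρ i
    positivity
  · rw [majorant, ← prod_mul_distrib]
    refine prod_congr rfl fun i _ => ?_
    rw [div_eq_mul_inv, mul_pow]
    ring

theorem absConv_of_norm_coeff_le {C : ℝ}
    (hF : ∀ k, ‖MvPowerSeries.coeff k F‖ ≤ C * majorant ρ k) (hz : z ∈ polydisc 0 ρ) :
    AbsConv F z := by
  refine .of_nonneg_of_le (fun _ => norm_nonneg _) (fun k => ?_)
    ((summable_majorant_mul hz).mul_left C)
  rw [norm_term, ← mul_assoc]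
  gcongr
  exact hF k

theorem hasSum_toFun {ι : Type*} {q : ι → MvPowerSeries (Fin m) ℂ} {c : ι → ℝ} (hc : Summable c)
    (hq : ∀ n k, ‖MvPowerSeries.coeff k (q n)‖ ≤ c n * majorant ρ k)
    (hF : ∀ k, HasSum (fun n => MvPowerSeries.coeff k (q n)) (MvPowerSeries.coeff k F))
    (hz : z ∈ polydisc 0 ρ) : HasSum (fun n => toFun (q n) z) (toFun F z) := by
  have hsum : Summable fun x : (Fin m →₀ ℕ) × ι => term (q x.2) z x.1 := by
    refine .of_norm_bounded
      (summable_mul_of_summable_norm (summable_majorant_mul hz).norm hc.norm) fun x => ?_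
    rw [norm_term, mul_right_comm, mul_comm (majorant ρ x.1)]
    gcongr
    exact hq x.2 x.1
  have htotal : toFun F z = ∑' x : (Fin m →₀ ℕ) × ι, term (q x.2) z x.1 :=
    (hsum.hasSum.prod_fiberwise fun k => (hF k).mul_right (∏ i, z i ^ k i)).tsum_eq
  have hswap := (Equiv.prodComm ι (Fin m →₀ ℕ)).hasSum_iff.2 hsum.hasSum
  rw [htotal]
  exact hswap.prod_fiberwise fun n => (hswap.summable.prod_factor n).hasSum

theorem exists_forall_hasSum_coeff {σ ι A : Type*} [NormedRing A] [CompleteSpace A]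
    {q : ι → MvPowerSeries σ A} {c : ι → ℝ} {C : ℝ} {W : (σ →₀ ℕ) → ℝ} (hc : HasSum c C)
    (hq : ∀ n k, ‖MvPowerSeries.coeff k (q n)‖ ≤ c n * W k) :
    ∃ s : MvPowerSeries σ A,
      (∀ k, HasSum (fun n => MvPowerSeries.coeff k (q n)) (MvPowerSeries.coeff k s)) ∧
      ∀ k, ‖MvPowerSeries.coeff k s‖ ≤ C * W k := by
  have hs (k : σ →₀ ℕ) : HasSum (fun n => MvPowerSeries.coeff k (q n))
      (∑' n, MvPowerSeries.coeff k (q n)) :=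
    (Summable.of_norm_bounded (hc.mul_right (W k)).summable fun n => hq n k).hasSum
  exact ⟨fun k => ∑' n, MvPowerSeries.coeff k (q n), hs,
    fun k => (hs k).norm_le_of_bounded (hc.mul_right (W k)) fun n => hq n k⟩

theorem one_le_majorant (hρ : ∀ i, 0 < ρ i ∧ ρ i ≤ 1) (k : Fin m →₀ ℕ) : 1 ≤ majorant ρ k := by
  refine Finset.one_le_prod fun i _ => one_le_mul_of_one_le_of_one_le ?_ ?_
  · simp
  · exact one_le_pow₀ ((one_le_inv₀ (hρ i).1).2 (hρ i).2)

theorem sum_add_one_le_prod_add_one {ι : Type*} (s : Finset ι) {a : ι → ℝ}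
    (ha : ∀ i ∈ s, 0 ≤ a i) : ∑ i ∈ s, a i + 1 ≤ ∏ i ∈ s, (a i + 1) := by
  classical
  induction s using Finset.induction_on with
  | empty => simp
  | insert j s hj ih =>
    rw [forall_mem_insert] at ha
    rw [sum_insert hj, prod_insert hj]
    nlinarith [ih ha.2, sum_nonneg ha.2]

theorem degree_le_majorant (hρ : ∀ i, 0 < ρ i ∧ ρ i ≤ 1) (k : Fin m →₀ ℕ) :
    (k.degree : ℝ) ≤ majorant ρ k := by
  calc (k.degree : ℝ) ≤ ∑ i, (k i : ℝ) + 1 := by simp [Finsupp.degree_eq_sum]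
    _ ≤ ∏ i, (k i + 1 : ℝ) := sum_add_one_le_prod_add_one univ fun i _ => by positivity
    _ ≤ majorant ρ k := prod_le_prod (fun i _ => by positivity) fun i _ =>
        le_mul_of_one_le_right (by positivity)
          (one_le_pow₀ ((one_le_inv₀ (hρ i).1).2 (hρ i).2))

end Majorant

section IntegerSeries

variable {m : ℕ} {f : MvPowerSeries (Fin m) ℤ} {z : Fin m → ℂ}

theorem coeff_toComplex (f : MvPowerSeries (Fin m) ℤ) (k : Fin m →₀ ℕ) :
    MvPowerSeries.coeff k (toComplex f) = MvPowerSeries.coeff k f := by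
  simp [toComplex]

theorem norm_coeff_toComplex (f : MvPowerSeries (Fin m) ℤ) (k : Fin m →₀ ℕ) :
    ‖MvPowerSeries.coeff k (toComplex f)‖ = ‖MvPowerSeries.coeff k f‖ := by
  rw [coeff_toComplex, Complex.norm_intCast, Int.norm_eq_abs]

theorem absConv_toComplex {C : ℝ} {ρ : Fin m → ℝ}
    (hf : ∀ k, ‖MvPowerSeries.coeff k f‖ ≤ C * majorant ρ k) (hz : z ∈ polydisc 0 ρ) :
    AbsConv (toComplex f) z :=
  absConv_of_norm_coeff_le (fun k => (norm_coeff_toComplex f k).trans_le (hf k)) hz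

theorem toComplex_add (f g : MvPowerSeries (Fin m) ℤ) :
    toComplex (f + g) = toComplex f + toComplex g :=
  map_add _ f g

theorem toFun_zero (F : MvPowerSeries (Fin m) ℂ) :
    toFun F 0 = MvPowerSeries.coeff 0 F := by
  rw [toFun, tsum_eq_single 0 fun k hk => ?_]
  · simp [term]
  · obtain ⟨i, hi⟩ := Finsupp.ne_iff.1 hk
    rw [term, prod_eq_zero (mem_univ i) (by simpa using hi), mul_zero]

end IntegerSeries

section Rounding

variable {σ : Type*}

open Classical in
/-- The power series `h` with coefficients in `[0, 1)` for which `g + p * h` has integer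
coefficients, where `p` has constant coefficient `1`; its coefficients are determined one after
the other. -/
noncomputable def roundingSeries (g p : MvPowerSeries σ ℝ) : MvPowerSeries σ ℝ
  | k => Int.fract (-(MvPowerSeries.coeff k g + ∑ x ∈ antidiagonal k,
      if _ : x.2 < k then MvPowerSeries.coeff x.1 p * roundingSeries g p x.2 else 0))
termination_by k => k

open Classical in
theorem coeff_roundingSeries (g p : MvPowerSeries σ ℝ) (k : σ →₀ ℕ) :
    MvPowerSeries.coeff k (roundingSeries g p) =
      Int.fract (-(MvPowerSeries.coeff k g + ∑ x ∈ antidiagonal k, if x.2 < k then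
        MvPowerSeries.coeff x.1 p * MvPowerSeries.coeff x.2 (roundingSeries g p) else 0)) := by
  change roundingSeries g p k = _
  rw [roundingSeries]
  rfl

open Classical in
theorem coeff_mul_of_constantCoeff_eq_one {R : Type*} [CommRing R] {p : MvPowerSeries σ R}
    (hp : MvPowerSeries.constantCoeff p = 1) (h : MvPowerSeries σ R) (k : σ →₀ ℕ) :
    MvPowerSeries.coeff k (p * h) = MvPowerSeries.coeff k h + ∑ x ∈ antidiagonal k,
      if x.2 < k then MvPowerSeries.coeff x.1 p * MvPowerSeries.coeff x.2 h else 0 := by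
  have hmem : (0, k) ∈ antidiagonal k := by simp
  rw [MvPowerSeries.coeff_mul, ← add_sum_erase _ _ hmem, ← add_sum_erase _ _ hmem,
    MvPowerSeries.coeff_zero_eq_constantCoeff_apply, hp, one_mul, if_neg (lt_irrefl k), zero_add]
  refine congrArg _ (sum_congr rfl fun x hx => (if_pos ?_).symm)
  obtain ⟨hne, hx⟩ := mem_erase.1 hx
  rw [HasAntidiagonal.mem_antidiagonal] at hx
  have hx₁ : x.1 ≠ 0 := fun h => hne (Prod.ext h (by simpa [h] using hx))
  rw [← hx]
  exact lt_add_of_pos_left _ (pos_iff_ne_zero.2 hx₁)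

theorem exists_map_eq_add_mul (g : MvPowerSeries σ ℝ) {p : MvPowerSeries σ ℝ}
    (hp : MvPowerSeries.constantCoeff p = 1) :
    ∃ (q : MvPowerSeries σ ℤ) (h : MvPowerSeries σ ℝ),
      (∀ k, ‖MvPowerSeries.coeff k h‖ ≤ 1) ∧
      MvPowerSeries.map (Int.castRingHom ℝ) q = g + p * h := by
  classical
  have hround (r : ℝ) : ((-⌊-r⌋ : ℤ) : ℝ) = Int.fract (-r) + r := by
    rw [Int.fract, Int.cast_neg]
    ring
  have hinteger (k : σ →₀ ℕ) : ∃ n : ℤ, (n : ℝ) =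
      MvPowerSeries.coeff k (g + p * roundingSeries g p) := by
    rw [map_add, coeff_mul_of_constantCoeff_eq_one hp, add_left_comm, coeff_roundingSeries]
    exact ⟨_, hround _⟩
  choose q hq using hinteger
  refine ⟨q, roundingSeries g p, fun k => ?_, MvPowerSeries.ext hq⟩
  rw [coeff_roundingSeries, Real.norm_of_nonneg (Int.fract_nonneg _)]
  exact (Int.fract_lt_one _).le

/-- The length of a polynomial, the sum of the norms of its coefficients. -/
noncomputable def length {A : Type*} [NormedCommRing A] (p : MvPolynomial σ A) : ℝ :=
  ∑ d ∈ p.support, ‖p.coeff d‖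

theorem norm_coeff_le_length {A : Type*} [NormedCommRing A] (p : MvPolynomial σ A) (k : σ →₀ ℕ) :
    ‖p.coeff k‖ ≤ length p := by
  by_cases hk : k ∈ p.support
  · exact single_le_sum (f := fun d => ‖p.coeff d‖) (fun _ _ => norm_nonneg _) hk
  · rw [MvPolynomial.notMem_support_iff.1 hk, norm_zero]
    exact sum_nonneg fun _ _ => norm_nonneg _

theorem norm_coeff_coe_mul_le {A : Type*} [NormedCommRing A] (p : MvPolynomial σ A)
    {h : MvPowerSeries σ A} {M : ℝ} (hh : ∀ k, ‖MvPowerSeries.coeff k h‖ ≤ M) (k : σ →₀ ℕ) :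
    ‖MvPowerSeries.coeff k ((p : MvPowerSeries σ A) * h)‖ ≤ length p * M := by
  classical
  have hp : (p : MvPowerSeries σ A) = ∑ d ∈ p.support, MvPowerSeries.monomial d (p.coeff d) := by
    conv_lhs => rw [p.as_sum]
    simp only [← MvPolynomial.coeToMvPowerSeries.ringHom_apply, map_sum]
    simp
  have hM : 0 ≤ M := (norm_nonneg _).trans (hh 0)
  rw [hp, sum_mul, map_sum, length, sum_mul]
  refine norm_sum_le_of_le _ fun d _ => ?_
  rw [MvPowerSeries.coeff_monomial_mul]
  split_ifs with hd
  · exact (norm_mul_le _ _).trans (mul_le_mul_of_nonneg_left (hh _) (norm_nonneg _))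
  · rw [norm_zero]
    positivity

theorem map_coe {R S : Type*} [CommSemiring R] [CommSemiring S] (φ : R →+* S)
    (P : MvPolynomial σ R) :
    MvPowerSeries.map φ (P : MvPowerSeries σ R) = (MvPolynomial.map φ P : MvPolynomial σ S) := by
  ext k
  simp [MvPolynomial.coeff_map]

-- Where `p` vanishes, adding a multiple of `p` changes coefficients but not values.
theorem exists_norm_coeff_le_and_toFun_eq {m : ℕ} {p : MvPolynomial (Fin m) ℝ}
    (hp : MvPolynomial.constantCoeff p = 1) (G : MvPolynomial (Fin m) ℝ) :
    ∃ q : MvPowerSeries (Fin m) ℤ,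
      (∀ k, ‖MvPowerSeries.coeff k q‖ ≤ ‖G.coeff k‖ + length p) ∧
      ∀ z ∈ polydisc 0 1, MvPolynomial.aeval z p = 0 →
        toFun (toComplex q) z = MvPolynomial.aeval z G := by
  obtain ⟨q, h, hh, hq⟩ := exists_map_eq_add_mul (G : MvPowerSeries (Fin m) ℝ)
    (p := (p : MvPowerSeries (Fin m) ℝ)) hp
  refine ⟨q, fun k => ?_, fun z hz hpz => ?_⟩
  · have hk := congrArg (MvPowerSeries.coeff k) hq
    rw [MvPowerSeries.coeff_map, eq_intCast, map_add, MvPolynomial.coeff_coe] at hk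
    rw [← Int.norm_cast_real, hk]
    refine (norm_add_le _ _).trans (add_le_add_right ?_ _)
    simpa only [mul_one] using norm_coeff_coe_mul_le p hh k
  · have hqC : toComplex q = (MvPolynomial.map (algebraMap ℝ ℂ) G : MvPolynomial (Fin m) ℂ) +
        (MvPolynomial.map (algebraMap ℝ ℂ) p : MvPolynomial (Fin m) ℂ) *
          MvPowerSeries.map (algebraMap ℝ ℂ) h := by
      rw [← map_coe, ← map_coe, ← map_mul, ← map_add, ← hq]
      ext k
      simp [toComplex]
    have hconv : AbsConv (MvPowerSeries.map (algebraMap ℝ ℂ) h) z := by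
      refine absConv_of_norm_coeff_le (C := 1) (fun k => ?_) hz
      rw [MvPowerSeries.coeff_map, norm_algebraMap', one_mul]
      exact (hh k).trans (one_le_majorant (by simp) k)
    rw [hqC, toFun_add (absConv_coe _ _) ((absConv_coe _ _).mul hconv),
      toFun_mul (absConv_coe _ _) hconv, toFun_coe, toFun_coe, MvPolynomial.eval_map,
      MvPolynomial.eval_map, ← MvPolynomial.aeval_def, ← MvPolynomial.aeval_def, hpz, zero_mul,
      add_zero]

end Rounding

section Conjugation

theorem toFun_toComplex_star {m : ℕ} (f : MvPowerSeries (Fin m) ℤ) (z : Fin m → ℂ) :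
    toFun (toComplex f) (star z) = star (toFun (toComplex f) z) := by
  simp [toFun, term, coeff_toComplex, tsum_star]

variable {σ : Type*}

theorem aeval_star (P : MvPolynomial σ ℝ) (z : σ → ℂ) :
    MvPolynomial.aeval (star z) P = star (MvPolynomial.aeval z P) := by
  simp [MvPolynomial.aeval_def, MvPolynomial.eval₂_eq]

open Classical in
/-- The possible values at `b` of power series with real coefficients: the field `ℝ` if `b` is a
real point, and `ℂ` otherwise. -/
noncomputable def valueField (b : σ → ℂ) : Subfield ℂ :=
  if star b = b then Complex.ofRealHom.fieldRange else ⊤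

theorem mem_valueField {b : σ → ℂ} {c : ℂ} : c ∈ valueField b ↔ (star b = b → star c = c) := by
  unfold valueField
  split_ifs with hb
  · simp only [hb, true_imp_iff, RingHom.mem_fieldRange, Complex.ofRealHom_eq_coe]
    exact ⟨fun ⟨r, hr⟩ => by simp [← hr], fun h => ⟨c.re, Complex.conj_eq_iff_re.1 h⟩⟩
  · simp [hb]

theorem aeval_mem_valueField (P : MvPolynomial σ ℝ) (b : σ → ℂ) :
    MvPolynomial.aeval b P ∈ valueField b :=
  mem_valueField.2 fun hb => by rw [← aeval_star, hb]

theorem toFun_toComplex_mem_valueField {m : ℕ} (f : MvPowerSeries (Fin m) ℤ) (b : Fin m → ℂ) :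
    toFun (toComplex f) b ∈ valueField b :=
  mem_valueField.2 fun hb => by rw [← toFun_toComplex_star, hb]

end Conjugation

section RealPolynomials

variable {σ : Type*} {a b : σ → ℂ} {E : Finset (σ → ℂ)}

theorem exists_aeval_eq_zero_of_ne (h : b ≠ a) (hstar : star b ≠ a) :
    ∃ Q : MvPolynomial σ ℝ, MvPolynomial.aeval a Q = 0 ∧ MvPolynomial.aeval b Q ≠ 0 := by
  obtain ⟨i, hi⟩ := Function.ne_iff.1 h
  obtain ⟨j, hj⟩ : ∃ j, b j ≠ star (a j) :=
    Function.ne_iff.1 fun hb => hstar (by rw [hb]; exact star_star a)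
  -- The real and imaginary parts of `(X i - a i) * (X j - star (a j))`.
  let A : MvPolynomial σ ℝ := .X i * .X j - .C (a j).re * .X i - .C (a i).re * .X j +
    .C ((a i).re * (a j).re + (a i).im * (a j).im)
  let B : MvPolynomial σ ℝ := .C (a j).im * .X i - .C (a i).im * .X j +
    .C ((a i).im * (a j).re - (a i).re * (a j).im)
  have hA : MvPolynomial.aeval a A = 0 := by
    simp only [A, map_add, map_sub, map_mul, MvPolynomial.aeval_X, MvPolynomial.aeval_C]
    apply Complex.ext <;> simp <;> ring
  have hB : MvPolynomial.aeval a B = 0 := by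
    simp only [B, map_add, map_sub, map_mul, MvPolynomial.aeval_X, MvPolynomial.aeval_C]
    apply Complex.ext <;> simp <;> ring
  have hAB : MvPolynomial.aeval b A + Complex.I * MvPolynomial.aeval b B =
      (b i - a i) * (b j - star (a j)) := by
    simp only [A, B, map_add, map_sub, map_mul, MvPolynomial.aeval_X, MvPolynomial.aeval_C]
    apply Complex.ext <;> simp <;> ring
  by_cases hbA : MvPolynomial.aeval b A = 0
  · refine ⟨B, hB, fun hbB => ?_⟩
    rw [hbA, hbB, mul_zero, add_zero] at hAB
    exact mul_ne_zero (sub_ne_zero.2 hi) (sub_ne_zero.2 hj) hAB.symm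
  · exact ⟨A, hA, hbA⟩

theorem exists_aeval_eq_zero_of_notMem (h : b ∉ E) (hstar : star b ∉ E) :
    ∃ Q : MvPolynomial σ ℝ, (∀ a ∈ E, MvPolynomial.aeval a Q = 0) ∧
      MvPolynomial.aeval b Q ≠ 0 := by
  have hsep : ∀ a ∈ E, ∃ Q : MvPolynomial σ ℝ,
      MvPolynomial.aeval a Q = 0 ∧ MvPolynomial.aeval b Q ≠ 0 := fun a ha =>
    exists_aeval_eq_zero_of_ne (ne_of_mem_of_not_mem ha h).symm
      (ne_of_mem_of_not_mem ha hstar).symm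
  choose! Q hQa hQb using hsep
  refine ⟨∏ a ∈ E, Q a, fun a ha => ?_, ?_⟩
  · rw [map_prod]
    exact prod_eq_zero ha (hQa a ha)
  · rw [map_prod]
    exact prod_ne_zero_iff.2 hQb

theorem exists_constantCoeff_eq_one_and_aeval_eq_zero (h : 0 ∉ E) :
    ∃ p : MvPolynomial σ ℝ, MvPolynomial.constantCoeff p = 1 ∧
      ∀ a ∈ E, MvPolynomial.aeval a p = 0 := by
  obtain ⟨Q, hQE, hQ0⟩ := exists_aeval_eq_zero_of_notMem h (by rwa [star_zero])
  have hQ : MvPolynomial.constantCoeff Q ≠ 0 := fun h0 => hQ0 (by simp [h0])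
  refine ⟨.C (MvPolynomial.constantCoeff Q)⁻¹ * Q, ?_, fun a ha => ?_⟩
  · rw [map_mul, MvPolynomial.constantCoeff_C, inv_mul_cancel₀ hQ]
  · rw [map_mul, hQE a ha, mul_zero]

theorem exists_forall_aeval_re_add_im_mul_eq (b : σ → ℂ) :
    ∃ J : MvPolynomial σ ℝ, ∀ c ∈ valueField b,
      MvPolynomial.aeval b (.C c.re + .C c.im * J) = c := by
  by_cases hb : star b = b
  · refine ⟨0, fun c hc => ?_⟩
    simpa using Complex.conj_eq_iff_re.1 (mem_valueField.1 hc hb)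
  · obtain ⟨i, hi⟩ := Function.ne_iff.1 hb
    have him : (b i).im ≠ 0 := fun h => hi (Complex.conj_eq_iff_im.2 h)
    refine ⟨.C (b i).im⁻¹ * (.X i - .C (b i).re), fun c _ => ?_⟩
    simp only [map_add, map_sub, map_mul, MvPolynomial.aeval_X, MvPolynomial.aeval_C]
    apply Complex.ext
    · simp
    · simp [him]

end RealPolynomials

section Correction

variable {m : ℕ} {E : Finset (Fin m → ℂ)} {b : Fin m → ℂ}

theorem exists_bound_forall_exists_toFun_eq (hE : ∀ a ∈ E, a ∈ polydisc 0 1) (hE₀ : 0 ∉ E)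
    (hb : b ∈ polydisc 0 1) (hb₀ : b ≠ 0) (hbE : b ∉ E) (hbE' : star b ∉ E) :
    ∃ C, ∀ c ∈ valueField b, ‖c‖ ≤ 1 → ∃ q : MvPowerSeries (Fin m) ℤ,
      (∀ k, ‖MvPowerSeries.coeff k q‖ ≤ C) ∧ (∀ a ∈ E, toFun (toComplex q) a = 0) ∧
      toFun (toComplex q) b = c := by
  classical
  obtain ⟨Q, hQE, hQb⟩ := exists_aeval_eq_zero_of_notMem hbE hbE'
  obtain ⟨p, hp₀, hp⟩ := exists_constantCoeff_eq_one_and_aeval_eq_zero (E := insert b E)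
    (by simp [hb₀.symm, hE₀])
  obtain ⟨J, hJ⟩ := exists_forall_aeval_re_add_im_mul_eq b
  set w := MvPolynomial.aeval b Q
  refine ⟨length Q * (‖w‖⁻¹ * (1 + length J)) + length p, fun c hc hc1 => ?_⟩
  have hcw : ‖c / w‖ ≤ ‖w‖⁻¹ := by
    rw [norm_div, div_eq_mul_inv]
    exact mul_le_of_le_one_left (by positivity) hc1
  set R : MvPolynomial (Fin m) ℝ := .C (c / w).re + .C (c / w).im * J
  have hR (k : Fin m →₀ ℕ) : ‖R.coeff k‖ ≤ ‖w‖⁻¹ * (1 + length J) := by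
    rw [MvPolynomial.coeff_add, MvPolynomial.coeff_C_mul, MvPolynomial.coeff_C, mul_add, mul_one]
    refine norm_add_le_of_le ?_ ((norm_mul_le _ _).trans ?_)
    · split_ifs
      · exact (Complex.abs_re_le_norm _).trans hcw
      · simp
    · exact mul_le_mul ((Complex.abs_im_le_norm _).trans hcw) (norm_coeff_le_length J k)
        (norm_nonneg _) (by positivity)
  obtain ⟨q, hq, hqval⟩ := exists_norm_coeff_le_and_toFun_eq hp₀ (Q * R)
  refine ⟨q, fun k => (hq k).trans (add_le_add_left ?_ _), fun a ha => ?_, ?_⟩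
  · rw [← MvPolynomial.coeff_coe, MvPolynomial.coe_mul]
    exact norm_coeff_coe_mul_le Q (by simpa using hR) k
  · rw [hqval a (hE a ha) (hp a (mem_insert_of_mem ha)), map_mul, hQE a ha, zero_mul]
  · rw [hqval b hb (hp b (mem_insert_self b E)), map_mul,
      hJ _ (div_mem hc (aeval_mem_valueField Q b)), mul_div_cancel₀ _ hQb]

theorem norm_coeff_X_pow_mul_le {σ R : Type*} [NormedCommRing R] {q : MvPowerSeries σ R}
    {C ε : ℝ} {N : ℕ} (hε : 0 ≤ ε) (hC : C ≤ ε * N) (hq : ∀ k, ‖MvPowerSeries.coeff k q‖ ≤ C)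
    (j : σ) (k : σ →₀ ℕ) :
    ‖MvPowerSeries.coeff k (MvPowerSeries.X j ^ N * q)‖ ≤ ε * k.degree := by
  classical
  rw [MvPowerSeries.X_pow_eq, MvPowerSeries.coeff_monomial_mul]
  split_ifs with hk
  · have hN : N ≤ k.degree := (by simpa using hk j : N ≤ k j).trans (Finsupp.le_degree j k)
    rw [one_mul]
    exact (hq _).trans (hC.trans (by gcongr))
  · rw [norm_zero]
    positivity

theorem toFun_toComplex_X_pow_mul {q : MvPowerSeries (Fin m) ℤ} {a : Fin m → ℂ}
    (hq : AbsConv (toComplex q) a) (j : Fin m) (N : ℕ) :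
    toFun (toComplex (MvPowerSeries.X j ^ N * q)) a = a j ^ N * toFun (toComplex q) a := by
  have hX : toComplex (MvPowerSeries.X j ^ N * q) =
      ((MvPolynomial.X j ^ N : MvPolynomial (Fin m) ℂ) : MvPowerSeries (Fin m) ℂ) *
        toComplex q := by
    simp [toComplex]
  rw [hX, toFun_mul (absConv_coe _ _) hq, toFun_coe, map_pow, MvPolynomial.eval_X]

-- Multiplying by `X j ^ N` with `b j ≠ 0` and `N` large makes bounded coefficients small
-- compared to the degree.
theorem exists_pos_forall_exists_toFun_eq (hE : ∀ a ∈ E, a ∈ polydisc 0 1) (hE₀ : 0 ∉ E)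
    (hb : b ∈ polydisc 0 1) (hb₀ : b ≠ 0) (hbE : b ∉ E) (hbE' : star b ∉ E) {ε : ℝ}
    (hε : 0 < ε) :
    ∃ δ > 0, ∀ c ∈ valueField b, ‖c‖ < δ → ∃ q : MvPowerSeries (Fin m) ℤ,
      (∀ k, ‖MvPowerSeries.coeff k q‖ ≤ ε * k.degree) ∧ (∀ a ∈ E, toFun (toComplex q) a = 0) ∧
      toFun (toComplex q) b = c := by
  obtain ⟨C, hC⟩ := exists_bound_forall_exists_toFun_eq hE hE₀ hb hb₀ hbE hbE'
  obtain ⟨j, hj⟩ : ∃ j, b j ≠ 0 := Function.ne_iff.1 hb₀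
  obtain ⟨N, hN⟩ := exists_nat_ge (C / ε)
  rw [div_le_iff₀' hε] at hN
  have hw : b j ^ N ∈ valueField b :=
    pow_mem (by simpa using aeval_mem_valueField (.X j) b) N
  have hw₀ : 0 < ‖b j ^ N‖ := norm_pos_iff.2 (pow_ne_zero N hj)
  refine ⟨‖b j ^ N‖, hw₀, fun c hc hcδ => ?_⟩
  obtain ⟨q, hq, hqE, hqb⟩ := hC (c / b j ^ N) (div_mem hc hw)
    (by rw [norm_div]; exact (div_le_one hw₀).2 hcδ.le)
  have hconv {a : Fin m → ℂ} (ha : a ∈ polydisc 0 1) : AbsConv (toComplex q) a :=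
    absConv_toComplex (C := C) (fun k => (hq k).trans (le_mul_of_one_le_right
      ((norm_nonneg _).trans (hq 0)) (one_le_majorant (by simp) k))) ha
  refine ⟨MvPowerSeries.X j ^ N * q, norm_coeff_X_pow_mul_le hε.le hN hq j, fun a ha => ?_, ?_⟩
  · rw [toFun_toComplex_X_pow_mul (hconv (hE a ha)), hqE a ha, mul_zero]
  · rw [toFun_toComplex_X_pow_mul (hconv hb), hqb, mul_div_cancel₀ _ (pow_ne_zero N hj)]

end Correction

section Interpolation

variable {m : ℕ}

theorem exists_toFun_eq_zero_and_add_toFun_mem {E : Finset (Fin m → ℂ)} {b : Fin m → ℂ}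
    (hE : ∀ a ∈ E, a ∈ polydisc 0 1) (hE₀ : 0 ∉ E) (hb : b ∈ polydisc 0 1) (hb₀ : b ≠ 0)
    (hbE : b ∉ E) (hbE' : star b ∉ E) {ε : ℝ} (hε : 0 < ε) {v : ℂ} (hv : v ∈ valueField b)
    {T : Set ℂ} (hT : (valueField b : Set ℂ) ⊆ closure (T ∩ valueField b)) :
    ∃ q : MvPowerSeries (Fin m) ℤ, (∀ k, ‖MvPowerSeries.coeff k q‖ ≤ ε * k.degree) ∧
      (∀ a ∈ E, toFun (toComplex q) a = 0) ∧ v + toFun (toComplex q) b ∈ T := by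
  obtain ⟨δ, hδ, h⟩ := exists_pos_forall_exists_toFun_eq hE hE₀ hb hb₀ hbE hbE' hε
  obtain ⟨t, ⟨htT, htb⟩, ht⟩ := Metric.mem_closure_iff.1 (hT hv) δ hδ
  obtain ⟨q, hq, hqE, hqb⟩ := h (t - v) (sub_mem htb hv) (by rwa [← dist_eq_norm, dist_comm])
  exact ⟨q, hq, hqE, by rwa [hqb, add_sub_cancel]⟩

theorem exists_forall_sum_range {M : Type*} [AddCommMonoid M] {P : ℕ → M → M → Prop}
    (h : ∀ n x, ∃ y, P n x y) : ∃ y : ℕ → M, ∀ n, P n (∑ j ∈ range n, y j) (y n) := by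
  choose y hy using h
  let x : ℕ → M := fun n => Nat.rec 0 (fun n x => x + y n x) n
  have hx (n : ℕ) : ∑ j ∈ range n, y j (x j) = x n := by
    induction n with
    | zero => rfl
    | succ n ih => rw [sum_range_succ, ih]
  exact ⟨fun n => y n (x n), fun n => by rw [hx]; exact hy n (x n)⟩

variable {α : ℕ → Fin m → ℂ}

theorem exists_interpolating_sequence (hα : ∀ n, α n ∈ polydisc 0 1) (hα₀ : ∀ n, α n ≠ 0)
    (hne : Pairwise fun i j => α i ≠ α j ∧ star (α i) ≠ α j) {v : ℕ → ℂ}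
    (hv : ∀ n, v n ∈ valueField (α n)) {T : ℕ → Set ℂ}
    (hT : ∀ n, (valueField (α n) : Set ℂ) ⊆ closure (T n ∩ valueField (α n)))
    {c : ℕ → ℝ} (hc : ∀ n, 0 < c n) :
    ∃ q : ℕ → MvPowerSeries (Fin m) ℤ, (∀ n k, ‖MvPowerSeries.coeff k (q n)‖ ≤ c n * k.degree) ∧
      ∀ n, (∀ j < n, toFun (toComplex (q n)) (α j) = 0) ∧
        v n + toFun (toComplex (∑ j ∈ range n, q j)) (α n) + toFun (toComplex (q n)) (α n) ∈
          T n := by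
  classical
  obtain ⟨q, hq⟩ := exists_forall_sum_range fun n (F : MvPowerSeries (Fin m) ℤ) =>
    exists_toFun_eq_zero_and_add_toFun_mem (E := (range n).image α) (by simp [hα])
      (by simp [hα₀]) (hα n) (hα₀ n)
      (by simpa using fun j hj => (hne (ne_of_lt hj).symm).1.symm)
      (by simpa using fun j hj => (hne (ne_of_lt hj).symm).2.symm) (hc n)
      (add_mem (hv n) (toFun_toComplex_mem_valueField F (α n))) (hT n)
  exact ⟨q, fun n => (hq n).1, fun n => ⟨fun j hj =>
    (hq n).2.1 _ (mem_image_of_mem α (mem_range.2 hj)), (hq n).2.2⟩⟩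

theorem exists_interpolating (hα : ∀ n, α n ∈ polydisc 0 1) (hα₀ : ∀ n, α n ≠ 0)
    (hne : Pairwise fun i j => α i ≠ α j ∧ star (α i) ≠ α j) {v : ℕ → ℂ}
    (hv : ∀ n, v n ∈ valueField (α n)) {T : ℕ → Set ℂ}
    (hT : ∀ n, (valueField (α n) : Set ℂ) ⊆ closure (T n ∩ valueField (α n))) :
    ∃ s : MvPowerSeries (Fin m) ℤ, (∀ k, ‖MvPowerSeries.coeff k s‖ ≤ k.degree) ∧
      ∀ n, v n + toFun (toComplex s) (α n) ∈ T n := by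
  have hgeom := hasSum_geometric_two' 1
  obtain ⟨q, hq, hqα⟩ := exists_interpolating_sequence hα hα₀ hne hv hT
    (c := fun n => 1 / 2 / 2 ^ n) fun n => by positivity
  obtain ⟨s, hs, hs_le⟩ := exists_forall_hasSum_coeff hgeom hq
  refine ⟨s, by simpa only [one_mul] using hs_le, fun n => ?_⟩
  have hq_le (j : ℕ) (k : Fin m →₀ ℕ) :
      ‖MvPowerSeries.coeff k (q j)‖ ≤ 1 / 2 / 2 ^ j * majorant 1 k :=
    (hq j k).trans (by gcongr; exact degree_le_majorant (by simp) k)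
  have hsum : HasSum (fun j => toFun (toComplex (q j)) (α n)) (toFun (toComplex s) (α n)) :=
    hasSum_toFun hgeom.summable (fun j k => (norm_coeff_toComplex _ k).trans_le (hq_le j k))
      (fun k => by
        simp only [coeff_toComplex]
        exact (hs k).map (Int.castAddHom ℂ) continuous_of_discreteTopology) (hα n)
  have hvalue : toFun (toComplex s) (α n) = ∑ j ∈ range (n + 1), toFun (toComplex (q j)) (α n) :=
    hsum.unique <| hasSum_sum_of_ne_finset_zero fun j hj =>
      (hqα j).1 n (by simpa using hj)
  have hpartial : toFun (toComplex (∑ j ∈ range n, q j)) (α n) =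
      ∑ j ∈ range n, toFun (toComplex (q j)) (α n) := by
    rw [toComplex, map_sum]
    exact toFun_sum _ fun j _ => absConv_toComplex (hq_le j) (hα n)
  rw [hvalue, sum_range_succ, ← hpartial, ← add_assoc]
  exact (hqα n).2

end Interpolation

section Density

theorem dense_setOf_isAlgebraic (𝕜 : Type*) [RCLike 𝕜] : Dense {t : 𝕜 | IsAlgebraic ℚ t} := by
  have hre_im : Function.Surjective fun x : ℝ × ℝ => (x.1 + x.2 * RCLike.I : 𝕜) :=
    fun c => ⟨(RCLike.re c, RCLike.im c), RCLike.re_add_im c⟩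
  have hrat : DenseRange fun x : ℚ × ℚ => ((x.1 : ℝ) + (x.2 : ℝ) * RCLike.I : 𝕜) :=
    hre_im.denseRange.comp (Rat.denseRange_cast.prodMap Rat.denseRange_cast) (by fun_prop)
  have hI : IsAlgebraic ℚ (RCLike.I : 𝕜) := by
    rcases RCLike.I_mul_I (K := 𝕜) with h | h
    · exact h ▸ isAlgebraic_zero
    · refine .of_pow two_pos ?_
      rw [pow_two, h]
      exact isAlgebraic_one.neg
  refine hrat.mono ?_
  rintro _ ⟨x, rfl⟩
  simpa using (isAlgebraic_ratCast ℚ x.1).add ((isAlgebraic_ratCast ℚ x.2).mul hI)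

theorem dense_setOf_isAlgebraic_iff (𝕜 : Type*) [RCLike 𝕜] (A : Prop) :
    Dense {t : 𝕜 | IsAlgebraic ℚ t ↔ A} := by
  by_cases hA : A
  · simpa only [hA, iff_true] using dense_setOf_isAlgebraic 𝕜
  · simpa only [hA, iff_false, Set.compl_ofPred] using (Algebraic.countable ℚ 𝕜).dense_compl 𝕜

theorem valueField_subset_closure {σ : Type*} (b : σ → ℂ) (A : Prop) (u : ℂ) :
    (valueField b : Set ℂ) ⊆
      closure ({t | (IsAlgebraic ℚ t ↔ A) ∧ t ≠ u} ∩ valueField b) := by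
  intro c hc
  by_cases hb : star b = b
  · rw [← Complex.conj_eq_iff_re.1 (mem_valueField.1 hc hb)]
    refine map_mem_closure Complex.continuous_ofReal
      (((dense_setOf_isAlgebraic_iff ℝ A).sdiff_singleton u.re) c.re) fun t ht => ⟨⟨?_, ?_⟩, ?_⟩
    · exact (isAlgebraic_algebraMap_iff (algebraMap ℝ ℂ).injective).trans ht.1
    · rintro rfl
      exact ht.2 rfl
    · exact mem_valueField.2 fun _ => Complex.conj_ofReal t
  · exact closure_mono (fun t ht => Set.mem_inter ht (mem_valueField.2 fun h => absurd h hb))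
      (((dense_setOf_isAlgebraic_iff ℂ A).sdiff_singleton u) c)

end Density

section Enumeration

theorem exists_enumeration_of_involutive {β : Type*} {B : Set β} (hB : B.Countable)
    (hB' : B.Infinite) {τ : β → β} (hτ : Function.Involutive τ) :
    ∃ α : ℕ → β, (∀ n, α n ∈ B) ∧ (Pairwise fun i j => α i ≠ α j ∧ τ (α i) ≠ α j) ∧
      ∀ z ∈ B, ∃ n, z = α n ∨ z = τ (α n) := by
  let orbit : β → Sym2 β := fun z => s(z, τ z)
  have horbit {x y : β} : orbit x = orbit y ↔ x = y ∨ x = τ y := by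
    simp only [orbit, Sym2.eq_iff]
    grind [Function.Involutive]
  have hcount : Countable (orbit '' B) := (hB.image orbit).to_subtype
  have hinf : Infinite (orbit '' B) := by
    refine Set.infinite_coe_iff.2 fun hfin => hB' ?_
    refine (hfin.preimage' ?_).subset (Set.subset_preimage_image orbit B)
    rintro _ ⟨y, -, rfl⟩
    exact (Set.toFinite {y, τ y}).subset fun x hx => horbit.1 hx
  obtain ⟨e⟩ : Nonempty (ℕ ≃ orbit '' B) := nonempty_equiv_of_countable
  choose α hα hαe using fun n => (e n).2
  have hinj {i j : ℕ} (h : orbit (α i) = orbit (α j)) : i = j :=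
    e.injective (Subtype.ext (by rw [← hαe, ← hαe, h]))
  refine ⟨α, hα, fun i j hij => ⟨fun h => hij (hinj (congrArg orbit h)),
    fun h => hij (hinj (horbit.2 (.inr ?_)))⟩, fun z hz => ⟨e.symm ⟨_, z, hz, rfl⟩, ?_⟩⟩
  · rw [← h, hτ]
  · rw [← horbit, hαe, e.apply_symm_apply]

variable {m : ℕ} {ρ : Fin m → ℝ}

theorem countable_algebraicPoints (Ω : Set (Fin m → ℂ)) : (algebraicPoints Ω).Countable := by
  have hsub : algebraicPoints Ω ⊆ Set.univ.pi fun _ => {x : ℂ | IsAlgebraic ℚ x} :=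
    fun z hz i _ => hz.2 i
  exact (Set.countable_univ_pi fun _ => Algebraic.countable ℚ ℂ).mono hsub

theorem infinite_algebraicPoints_polydisc [Nonempty (Fin m)] (hρ : ∀ i, 0 < ρ i) :
    (algebraicPoints (polydisc 0 ρ)).Infinite := by
  obtain ⟨i, hi⟩ := Finite.exists_min ρ
  obtain ⟨r, hr₀, hr⟩ := exists_rat_btwn (hρ i)
  refine Set.infinite_of_injOn_mapsTo (f := fun q : ℚ => Function.const (Fin m) (q : ℂ))
    (Function.const_injective.comp Rat.cast_injective).injOn ?_
    (Set.Ioo_infinite (Rat.cast_pos.1 hr₀))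
  refine fun q hq => ⟨fun j => ?_, fun _ => isAlgebraic_ratCast ℚ q⟩
  have hq₀ : 0 < (q : ℝ) := Rat.cast_pos.2 hq.1
  have hqr : (q : ℝ) < r := Rat.cast_lt.2 hq.2
  simpa [abs_of_pos hq₀] using (hqr.trans hr).trans_le (hi j)

theorem exists_enumeration_algebraicPoints [Nonempty (Fin m)] (hρ : ∀ i, 0 < ρ i) :
    ∃ α : ℕ → Fin m → ℂ, (∀ n, α n ∈ polydisc 0 ρ) ∧ (∀ n, α n ≠ 0) ∧
      (Pairwise fun i j => α i ≠ α j ∧ star (α i) ≠ α j) ∧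
      ∀ z ∈ algebraicPoints (polydisc 0 ρ), z ≠ 0 → ∃ n, z = α n ∨ z = star (α n) := by
  obtain ⟨α, hα, hne, hcover⟩ := exists_enumeration_of_involutive
    ((countable_algebraicPoints (polydisc 0 ρ)).mono Set.sdiff_subset)
    ((infinite_algebraicPoints_polydisc hρ).sdiff (Set.finite_singleton 0)) star_involutive
  exact ⟨α, fun n => (hα n).1.1, fun n => (hα n).2, hne, fun z hz hz₀ => hcover z ⟨hz, hz₀⟩⟩

end Enumeration

section Polyradius

variable {m : ℕ} {ρ : Fin m → ℝ}

theorem norm_apply_lt_of_absConv {F : MvPowerSeries (Fin m) ℂ} {z : Fin m → ℂ} (hF : AbsConv F z)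
    {i : Fin m} {r : ℝ} (hr : 0 < r)
    (hlow : ∀ N, r⁻¹ ^ N ≤ ‖MvPowerSeries.coeff (Finsupp.single i N) F‖) : ‖z i‖ < r := by
  by_contra! hi
  have hlim := (hF.comp_injective (Finsupp.single_injective i)).tendsto_atTop_zero
  obtain ⟨N, hN⟩ := (hlim.eventually (gt_mem_nhds one_pos)).exists
  refine hN.not_ge ?_
  calc (1 : ℝ) = r⁻¹ ^ N * r ^ N := by rw [← mul_pow, inv_mul_cancel₀ hr.ne', one_pow]
    _ ≤ ‖MvPowerSeries.coeff (Finsupp.single i N) F‖ * ‖z i‖ ^ N := by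
        gcongr
        exact hlow N
    _ = ‖term F z (Finsupp.single i N)‖ := by
        rw [norm_term, prod_eq_single i (by simp +contextual) (by simp),
          Finsupp.single_eq_same]

theorem hasPolyradius_of_le_norm_coeff (hρ : ∀ i, 0 < ρ i) {F : MvPowerSeries (Fin m) ℂ}
    (hF : ∀ z ∈ polydisc 0 ρ, AbsConv F z)
    (hlow : ∀ i N, (ρ i)⁻¹ ^ N ≤ ‖MvPowerSeries.coeff (Finsupp.single i N) F‖) :
    HasPolyradius F ρ := by
  refine Set.Subset.antisymm (fun z hz i => ?_) (interior_maximal hF (isOpen_polydisc 0 ρ))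
  rw [Pi.zero_apply, sub_zero]
  exact norm_apply_lt_of_absConv (absConv_of_mem_convergenceDomain hz) (hρ i) (hlow i)

/-- The majorant rounded up to integer coefficients, the first approximation to the series with
a given exceptional set: it already has polyradius `ρ`, and so does every sum with a series whose
coefficients are at most the degree. -/
noncomputable def ceilMajorant (ρ : Fin m → ℝ) : MvPowerSeries (Fin m) ℤ :=
  fun k => ⌈majorant ρ k⌉

theorem majorant_le_coeff_ceilMajorant (ρ : Fin m → ℝ) (k : Fin m →₀ ℕ) :
    majorant ρ k ≤ (MvPowerSeries.coeff k (ceilMajorant ρ) : ℤ) :=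
  Int.le_ceil _

theorem norm_coeff_ceilMajorant_le (hρ : ∀ i, 0 < ρ i ∧ ρ i ≤ 1) (k : Fin m →₀ ℕ) :
    ‖MvPowerSeries.coeff k (ceilMajorant ρ)‖ ≤ 2 * majorant ρ k := by
  have h := one_le_majorant hρ k
  have hceil : (MvPowerSeries.coeff k (ceilMajorant ρ) : ℤ) < majorant ρ k + 1 :=
    Int.ceil_lt_add_one _
  rw [Int.norm_eq_abs, abs_of_nonneg]
  · linarith
  · linarith [majorant_le_coeff_ceilMajorant ρ k]

theorem majorant_single (ρ : Fin m → ℝ) (i : Fin m) (N : ℕ) :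
    majorant ρ (Finsupp.single i N) = (N + 1) * (ρ i)⁻¹ ^ N := by
  rw [majorant, prod_eq_single i (by simp +contextual) (by simp),
    Finsupp.single_eq_same]

theorem hasPolyradius_ceilMajorant_add (hρ : ∀ i, 0 < ρ i ∧ ρ i ≤ 1)
    {s : MvPowerSeries (Fin m) ℤ} (hs : ∀ k, ‖MvPowerSeries.coeff k s‖ ≤ k.degree) :
    HasPolyradius (toComplex (ceilMajorant ρ + s)) ρ := by
  refine hasPolyradius_of_le_norm_coeff (fun i => (hρ i).1)
    (fun z hz => absConv_toComplex (C := 3) (fun k => ?_) hz) fun i N => ?_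
  · rw [map_add]
    linarith [norm_add_le_of_le (norm_coeff_ceilMajorant_le hρ k)
      ((hs k).trans (degree_le_majorant hρ k))]
  · have hpow : 1 ≤ (ρ i)⁻¹ ^ N := one_le_pow₀ ((one_le_inv₀ (hρ i).1).2 (hρ i).2)
    have hceil := majorant_le_coeff_ceilMajorant ρ (Finsupp.single i N)
    have hdeg := hs (Finsupp.single i N)
    rw [Finsupp.degree_single, Int.norm_eq_abs, abs_le] at hdeg
    rw [majorant_single] at hceil
    rw [norm_coeff_toComplex, map_add, Int.norm_eq_abs, Int.cast_add]
    refine le_trans ?_ (le_abs_self _)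
    nlinarith [mul_le_mul_of_nonneg_left hpow N.cast_nonneg]

end Polyradius

section ExceptionalSet

variable {m : ℕ} {ρ : Fin m → ℝ} {S : Set (Fin m → ℂ)}

theorem isAlgebraic_star_iff {x : ℂ} : IsAlgebraic ℚ (star x) ↔ IsAlgebraic ℚ x :=
  isAlgebraic_algHom_iff (Complex.conjAe.toAlgHom.restrictScalars ℚ) Complex.conjAe.injective

theorem isAlgebraic_toFun_toComplex_zero (f : MvPowerSeries (Fin m) ℤ) :
    IsAlgebraic ℚ (toFun (toComplex f) 0) := by
  rw [toFun_zero, coeff_toComplex]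
  exact isAlgebraic_intCast _

theorem exceptionalSet_toFun_toComplex_eq (hS : S ⊆ algebraicPoints (polydisc 0 ρ))
    (hconj : ∀ z ∈ S, star z ∈ S) (hzero : 0 ∈ S) {α : ℕ → Fin m → ℂ}
    (hα : ∀ z ∈ algebraicPoints (polydisc 0 ρ), z ≠ 0 → ∃ n, z = α n ∨ z = star (α n))
    {f : MvPowerSeries (Fin m) ℤ} (hf : ∀ n, IsAlgebraic ℚ (toFun (toComplex f) (α n)) ↔ α n ∈ S) :
    exceptionalSet (polydisc 0 ρ) (toFun (toComplex f)) = S := by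
  have hstar (z : Fin m → ℂ) : star z ∈ S ↔ z ∈ S :=
    ⟨fun h => star_star z ▸ hconj _ h, hconj z⟩
  have hmem (z : Fin m → ℂ) (hz : z ∈ algebraicPoints (polydisc 0 ρ)) :
      IsAlgebraic ℚ (toFun (toComplex f) z) ↔ z ∈ S := by
    rcases eq_or_ne z 0 with rfl | hz₀
    · exact iff_of_true (isAlgebraic_toFun_toComplex_zero f) hzero
    · obtain ⟨n, rfl | rfl⟩ := hα z hz hz₀
      · exact hf n
      · rw [toFun_toComplex_star, isAlgebraic_star_iff, hf, hstar]
  ext z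
  exact ⟨fun h => (hmem z h.1).1 h.2, fun h => ⟨hS h, (hmem z (hS h)).2 h⟩⟩

-- Diagonal argument: the value at the `n`-th point is kept away from that of the `n`-th series
-- of `C`.
theorem exists_notMem_and_exceptionalSet_eq [Nonempty (Fin m)] (hρ : ∀ i, 0 < ρ i ∧ ρ i ≤ 1)
    (hS : S ⊆ algebraicPoints (polydisc 0 ρ)) (hconj : ∀ z ∈ S, star z ∈ S) (hzero : 0 ∈ S)
    {C : Set (MvPowerSeries (Fin m) ℤ)} (hC : C.Countable) :
    ∃ f ∉ C, HasPolyradius (toComplex f) ρ ∧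
      exceptionalSet (polydisc 0 ρ) (toFun (toComplex f)) = S := by
  obtain ⟨g, hg⟩ := Set.countable_iff_exists_subset_range.1 hC
  obtain ⟨α, hα, hα₀, hne, hcover⟩ := exists_enumeration_algebraicPoints fun i => (hρ i).1
  obtain ⟨s, hs, hsα⟩ := exists_interpolating
    (fun n => polydisc_mono 0 (fun i => (hρ i).2) (hα n)) hα₀ hne
    (fun n => toFun_toComplex_mem_valueField (ceilMajorant ρ) (α n))
    fun n => valueField_subset_closure (α n) (α n ∈ S) (toFun (toComplex (g n)) (α n))
  have hvalue (n : ℕ) : toFun (toComplex (ceilMajorant ρ + s)) (α n) =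
      toFun (toComplex (ceilMajorant ρ)) (α n) + toFun (toComplex s) (α n) := by
    rw [toComplex_add]
    refine toFun_add (absConv_toComplex (norm_coeff_ceilMajorant_le hρ) (hα n))
      (absConv_toComplex (C := 1) (fun k => ?_) (hα n))
    rw [one_mul]
    exact (hs k).trans (degree_le_majorant hρ k)
  simp only [← hvalue] at hsα
  refine ⟨ceilMajorant ρ + s, fun hfC => ?_, hasPolyradius_ceilMajorant_add hρ hs,
    exceptionalSet_toFun_toComplex_eq hS hconj hzero hcover fun n => (hsα n).1⟩
  obtain ⟨n, hn⟩ := hg hfC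
  exact (hsα n).2 (by rw [hn])

end ExceptionalSet

end Exceptional

theorem theorem1 (m : ℕ) (hm : 1 ≤ m) (ρ : Fin m → ℝ) (hρ : ∀ i, 0 < ρ i ∧ ρ i ≤ 1)
    (S : Set (Fin m → ℂ))
    (hS : S ⊆ Exceptional.algebraicPoints (Exceptional.polydisc 0 ρ))
    (hconj : ∀ z ∈ S, (fun i => (starRingEnd ℂ) (z i)) ∈ S)
    (hzero : (0 : Fin m → ℂ) ∈ S) :
    ¬ Set.Countable {f : MvPowerSeries (Fin m) ℤ |
      Exceptional.HasPolyradius (Exceptional.toComplex f) ρ ∧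
      Exceptional.IsTranscendentalOn (Exceptional.polydisc 0 ρ)
        (Exceptional.toFun (Exceptional.toComplex f)) ∧
      Exceptional.exceptionalSet (Exceptional.polydisc 0 ρ)
        (Exceptional.toFun (Exceptional.toComplex f)) = S} := by
  intro hcount
  have : Nonempty (Fin m) := ⟨⟨0, hm⟩⟩
  obtain ⟨f, hf, hrad, hexc⟩ := Exceptional.exists_notMem_and_exceptionalSet_eq hρ hS hconj hzero
    (hcount.union Exceptional.countable_setOf_not_algebraicIndependent_toComplex)
  rw [Set.mem_union, not_or] at hf
  have hind := not_not.1 hf.2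
  exact hf.1 ⟨hrad, Exceptional.isTranscendentalOn_toFun (fun i => (hρ i).1)
    (fun _ hz => hrad.absConv hz) hind, hexc⟩
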